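/- Let $E$ and $F$ be (real) Banach lattices, let $\mathcal S\subset E$ be norm bounded, let $sol(\mathcal S)=\{x\in E:\ |x|\le |y| \text{ for some } y\in\mathcal S\}$ be its solid hull, and let $T:E\to F$ be a bounded linear operator. A net $(x_\alpha)$ in a Banach lattice is uaw-convergent to $x$ if $|x_\alpha-x|\wedge u\to 0$ weakly for every $u\ge 0$ in that lattice. The operator $T$ is uaw-continuous if $Tx_\alpha$ is uaw-convergent to $Tx$ whenever $x_\alpha$ is uaw-convergent to $x$. A norm bounded set $A\subset E$ is uaw-compact (respectively relatively uaw-compact) if every net in $A$ has a subnet that is uaw-convergent to a point of $A$ (respectively to a point of $E$). The operator $T$ is $\mathcal S$-L-weakly compact if $\|Tx_n\|\to 0$ for every sequence $(x_n)$ in $sol(\mathcal S)$ that is uaw-convergent to $0$. If $T$ is uaw-continuous, then the following statements are equivalent: 1. $T$ is $\mathcal S$-L-weakly compact. 2. $T(A)$ is relatively compact (in norm) for every relatively uaw-compact subset $A\subset sol(\mathcal S)$. 3. $T(A)$ is compact (in norm) for every uaw-compact subset $A\subset sol(\mathcal S)$. Moreover, the implications $1\Rightarrow 2$ and $1\Rightarrow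 3$ hold without assuming that $T$ is uaw-continuous. -/

import Mathlib

open Filter Topology

/-- Unbounded absolute weak (uaw) convergence of `x` to `a` along the filter `l`:
`|x i - a| ⊓ u` converges weakly to `0` along `l`, for every `u ≥ 0`. For a net `x : ι → E`,
take `l = atTop`. -/
def UawTendsto {ι E : Type*} [NormedAddCommGroup E] [NormedSpace ℝ E] [Lattice E]
    (x : ι → E) (l : Filter ι) (a : E) : Prop :=
  ∀ u : E, 0 ≤ u → ∀ f : StrongDual ℝ E, Tendsto (fun i => f (|x i - a| ⊓ u)) l (𝓝 0)

/-- `T` preserves uaw-convergence. Nets are expressed by filters on `E`, as in Mathlib's treatment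
of continuity. -/
def UawContinuous {E F : Type*} [NormedAddCommGroup E] [NormedSpace ℝ E] [Lattice E]
    [NormedAddCommGroup F] [NormedSpace ℝ F] [Lattice F] (T : E →L[ℝ] F) : Prop :=
  ∀ (l : Filter E) (a : E), UawTendsto (fun x => x) l a → UawTendsto (fun x => T x) l (T a)

/-- A norm bounded set `A` is uaw-compact if every net in `A` has a subnet which is uaw-convergent
to a point of `A`. Nets in `A` are expressed by proper filters containing `A`, and subnets by
finer proper filters, as in Mathlib's treatment of compactness. -/
def IsUawCompact {E : Type*} [NormedAddCommGroup E] [NormedSpace ℝ E] [Lattice E]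
    (A : Set E) : Prop :=
  Bornology.IsBounded A ∧
    ∀ l : Filter E, l.NeBot → l ≤ 𝓟 A →
      ∃ l' : Filter E, l'.NeBot ∧ l' ≤ l ∧ ∃ a ∈ A, UawTendsto (fun x => x) l' a

/-- A norm bounded set `A` is relatively uaw-compact if every net in `A` has a subnet which is
uaw-convergent to some point of the whole space. -/
def IsRelUawCompact {E : Type*} [NormedAddCommGroup E] [NormedSpace ℝ E] [Lattice E]
    (A : Set E) : Prop :=
  Bornology.IsBounded A ∧
    ∀ l : Filter E, l.NeBot → l ≤ 𝓟 A →
      ∃ l' : Filter E, l'.NeBot ∧ l' ≤ l ∧ ∃ a : E, UawTendsto (fun x => x) l' a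

/-- `T` is `S`-L-weakly compact: `‖T (x n)‖ → 0` for every uaw-null sequence `x` in the solid hull
`{y | ∃ z ∈ S, |y| ≤ |z|}` of `S`. The notion is used for norm bounded `S`. -/
def IsLWeaklyCompactOn {E Y : Type*} [NormedAddCommGroup E] [NormedSpace ℝ E] [Lattice E]
    [NormedAddCommGroup Y] [NormedSpace ℝ Y] (S : Set E) (T : E →L[ℝ] Y) : Prop :=
  ∀ x : ℕ → E, (∀ n, x n ∈ LatticeOrderedAddCommGroup.solidClosure S) →
    UawTendsto x atTop 0 → Tendsto (fun n => T (x n)) atTop (𝓝 0)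

/-!
Let `u ≥ 0` be such that `T` maps uaw-null sequences in `[-u, u]` to norm-null sequences. Then the
functionals `|f ∘ T|`, `‖f‖ ≤ 1`, are uniformly Cauchy along monotone sequences in `[0, u]`, and
this forces finitely many of them to control all the others on `[0, u]`. Smallness of finitely many
functionals is available along nets as well as along sequences, so `T` maps weakly null nets in
`[0, u]` to norm-null nets.

If `T` is `S`-L-weakly compact, a disjoint sequence argument produces, for each `ε > 0`, such a `u`
with `‖T (x - u)⁺‖ ≤ ε` for all positive `x` in the solid hull of `S`. As `x = (x - u)⁺ + x ⊓ u`,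
uaw-null nets in the solid hull have norm-null images, which gives the compactness statements.
Conversely, a uaw-null sequence together with `0` is uaw-compact, so its image under `T` is totally
bounded; and a uaw-null net which is norm Cauchy is norm null.
-/

section LatticeOrderedGroup

variable {E : Type*} [AddCommGroup E] [Lattice E] [IsOrderedAddMonoid E]

theorem add_inf_le_inf_add_inf {a b c : E} (ha : 0 ≤ a) (hb : 0 ≤ b) (hc : 0 ≤ c) :
    (a + b) ⊓ c ≤ a ⊓ c + b ⊓ c := by
  rw [add_inf, inf_add, inf_add]
  refine le_inf (le_inf inf_le_left ?_) (le_inf ?_ ?_)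
  · exact inf_le_right.trans (le_add_of_nonneg_right hb)
  · exact inf_le_right.trans (le_add_of_nonneg_left ha)
  · exact inf_le_right.trans (le_add_of_nonneg_left hc)

theorem abs_posPart_le_abs (a : E) : |a⁺| ≤ |a| := by
  rw [abs_of_nonneg (posPart_nonneg a)]
  exact sup_le (le_abs_self a) (abs_nonneg a)

/-- The Riesz decomposition property, for `[-(a + b), a + b]`. -/
theorem exists_add_eq_of_abs_le_add {a b y : E} (ha : 0 ≤ a) (hb : 0 ≤ b) (hy : |y| ≤ a + b) :
    ∃ y₁ y₂, y₁ + y₂ = y ∧ |y₁| ≤ a ∧ |y₂| ≤ b := by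
  obtain ⟨hy_le, hy_ge⟩ := abs_le'.1 hy
  have hab : -a ≤ a := (neg_nonpos.2 ha).trans ha
  refine ⟨y ⊓ a ⊔ -a, y - (y ⊓ a ⊔ -a), add_sub_cancel _ _, ?_, ?_⟩
  · exact abs_le'.2 ⟨sup_le inf_le_right hab, neg_le.1 le_sup_right⟩
  · refine abs_le'.2 ⟨?_, ?_⟩
    · rw [sub_le_comm]
      exact le_sup_of_le_left (le_inf (sub_le_self y hb) (sub_le_iff_le_add.2 hy_le))
    · rw [neg_sub, sub_le_iff_le_add]
      refine sup_le (inf_le_of_left_le (le_add_of_nonneg_left hb)) ?_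
      calc -a = b + -(a + b) := by abel
        _ ≤ b + y := by gcongr; exact neg_le.1 hy_ge

theorem exists_add_eq_of_abs_le_add_inf {a b y : E} (ha : 0 ≤ a) (hb : 0 ≤ b)
    (hy : |y| ≤ a + b) : ∃ y₁ y₂, y₁ + y₂ = y ∧ |y₁| ≤ a ⊓ |y| ∧ |y₂| ≤ b ⊓ |y| := by
  refine exists_add_eq_of_abs_le_add (le_inf ha (abs_nonneg y)) (le_inf hb (abs_nonneg y)) ?_
  calc |y| = (a + b) ⊓ |y| := (inf_eq_right.2 hy).symm
    _ ≤ a ⊓ |y| + b ⊓ |y| := add_inf_le_inf_add_inf ha hb (abs_nonneg y)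

theorem sum_inf_eq_zero {ι : Type*} {s : Finset ι} {d : ι → E} {c : E} (hd : ∀ i ∈ s, 0 ≤ d i)
    (hc : 0 ≤ c) (h : ∀ i ∈ s, d i ⊓ c = 0) : (∑ i ∈ s, d i) ⊓ c = 0 := by
  refine (Finset.sum_induction d (fun x => 0 ≤ x ∧ x ⊓ c = 0) ?_ ⟨le_rfl, inf_eq_left.2 hc⟩
    fun i hi => ⟨hd i hi, h i hi⟩).2
  rintro x y ⟨hx, hxc⟩ ⟨hy, hyc⟩
  refine ⟨add_nonneg hx hy, le_antisymm ?_ (le_inf (add_nonneg hx hy) hc)⟩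
  simpa only [hxc, hyc, add_zero] using add_inf_le_inf_add_inf hx hy hc

theorem sum_le_of_pairwise_inf_eq_zero {ι : Type*} {d : ι → E} {w : E} (hd : ∀ i, 0 ≤ d i)
    (hdisj : Pairwise fun i j => d i ⊓ d j = 0) (hw : 0 ≤ w) (hdw : ∀ i, d i ≤ w)
    (s : Finset ι) : ∑ i ∈ s, d i ≤ w := by
  classical
  induction s using Finset.induction_on with
  | empty => simpa using hw
  | insert i s hi ih =>
    have hdisj_sum : (∑ j ∈ s, d j) ⊓ d i = 0 :=
      sum_inf_eq_zero (fun j _ => hd j) (hd i) fun j hj => hdisj (ne_of_mem_of_not_mem hj hi)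
    rw [Finset.sum_insert hi, add_comm, ← inf_add_sup, hdisj_sum, zero_add]
    exact sup_le ih (hdw i)

theorem partialSups_le_sum {f : ℕ → E} (hf : ∀ i, 0 ≤ f i) (n : ℕ) :
    partialSups f n ≤ ∑ i ∈ Finset.range (n + 1), f i :=
  partialSups_le f n _ fun _ hi =>
    Finset.single_le_sum (fun j _ => hf j) (Finset.mem_range_succ_iff.2 hi)

section PositiveCone

variable {G : Type*} [AddCommGroup G] {h : E → G}

omit [IsOrderedAddMonoid E] in
theorem map_sub_map_eq_of_sub_eq_sub (h_add : ∀ x y, 0 ≤ x → 0 ≤ y → h (x + y) = h x + h y)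
    {a b c d : E} (ha : 0 ≤ a) (hb : 0 ≤ b) (hc : 0 ≤ c) (hd : 0 ≤ d) (hsub : a - b = c - d) :
    h a - h b = h c - h d := by
  rw [sub_eq_sub_iff_add_eq_add, ← h_add _ _ ha hd, ← h_add _ _ hc hb,
    sub_eq_sub_iff_add_eq_add.1 hsub]

/-- The additive extension to `E` of a map which is additive on the positive cone of `E`. -/
def extendPositiveCone (h_add : ∀ x y, 0 ≤ x → 0 ≤ y → h (x + y) = h x + h y) : E →+ G :=
  AddMonoidHom.mk' (fun x => h x⁺ - h x⁻) fun x y => by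
    have hpos := add_nonneg (posPart_nonneg x) (posPart_nonneg y)
    have hneg := add_nonneg (negPart_nonneg x) (negPart_nonneg y)
    rw [← add_sub_add_comm, ← h_add _ _ (posPart_nonneg x) (posPart_nonneg y),
      ← h_add _ _ (negPart_nonneg x) (negPart_nonneg y)]
    refine map_sub_map_eq_of_sub_eq_sub h_add (posPart_nonneg _) (negPart_nonneg _) hpos hneg ?_
    simp only [posPart_sub_negPart, add_sub_add_comm]

theorem extendPositiveCone_of_nonneg (h_add : ∀ x y, 0 ≤ x → 0 ≤ y → h (x + y) = h x + h y)
    {x : E} (hx : 0 ≤ x) : extendPositiveCone h_add x = h x := by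
  have h_zero : h 0 = 0 := by simpa using h_add 0 0 le_rfl le_rfl
  simp [extendPositiveCone, posPart_of_nonneg hx, negPart_of_nonneg hx, h_zero]

end PositiveCone

end LatticeOrderedGroup

section Modulus

variable {E : Type*} [NormedAddCommGroup E] [NormedSpace ℝ E] [Lattice E]

/-- The supremum of the functional `f` over the order interval `[-x, x]`; the value is meaningful
for `0 ≤ x`, where the interval is nonempty. -/
noncomputable def intervalSup (f : StrongDual ℝ E) (x : E) : ℝ := ⨆ y : {y : E // |y| ≤ x}, f y

variable (f : StrongDual ℝ E) {x y : E}

theorem intervalSup_le [IsOrderedAddMonoid E] {c : ℝ} (hx : 0 ≤ x) (hc : ∀ y, |y| ≤ x → f y ≤ c) :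
    intervalSup f x ≤ c :=
  have : Nonempty {y : E // |y| ≤ x} := ⟨0, by simpa using hx⟩
  ciSup_le fun y => hc y y.2

variable [HasSolidNorm E]

theorem apply_le_of_abs_le (hyx : |y| ≤ |x|) : f y ≤ ‖f‖ * ‖x‖ :=
  (le_abs_self _).trans <| (f.le_opNorm y).trans <| by
    gcongr
    exact norm_le_norm_of_abs_le_abs hyx

theorem le_intervalSup (hyx : |y| ≤ x) : f y ≤ intervalSup f x := by
  refine le_ciSup (f := fun y : {y : E // |y| ≤ x} => f y) ⟨‖f‖ * ‖x‖, ?_⟩ ⟨y, hyx⟩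
  rintro _ ⟨⟨z, hz⟩, rfl⟩
  exact apply_le_of_abs_le f (hz.trans (le_abs_self x))

variable [IsOrderedAddMonoid E]

theorem intervalSup_add (x y : E) (hx : 0 ≤ x) (hy : 0 ≤ y) :
    intervalSup f (x + y) = intervalSup f x + intervalSup f y := by
  apply le_antisymm
  · refine intervalSup_le f (add_nonneg hx hy) fun z hz => ?_
    obtain ⟨z₁, z₂, rfl, h₁, h₂⟩ := exists_add_eq_of_abs_le_add hx hy hz
    rw [map_add]
    exact add_le_add (le_intervalSup f h₁) (le_intervalSup f h₂)
  · rw [← le_sub_iff_add_le]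
    refine intervalSup_le f hx fun a ha => ?_
    rw [le_sub_comm]
    refine intervalSup_le f hy fun b hb => ?_
    rw [le_sub_iff_add_le', ← map_add]
    exact le_intervalSup f ((abs_add_le a b).trans (add_le_add ha hb))

theorem intervalSup_nonneg (hx : 0 ≤ x) : 0 ≤ intervalSup f x := by
  simpa using le_intervalSup f (y := 0) (by simpa using hx)

theorem norm_extendPositiveCone_intervalSup_le (x : E) :
    ‖extendPositiveCone (intervalSup_add f) x‖ ≤ ‖f‖ * ‖x‖ := by
  have bound : ∀ z, 0 ≤ z → |z| ≤ |x| → intervalSup f z ≤ ‖f‖ * ‖x‖ := fun z hz hzx =>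
    intervalSup_le f hz fun y hy => apply_le_of_abs_le f (hy.trans ((le_abs_self z).trans hzx))
  have hneg : |x⁻| ≤ |x| := by simpa only [posPart_neg, abs_neg] using abs_posPart_le_abs (-x)
  exact abs_sub_le_of_nonneg_of_le (intervalSup_nonneg f (posPart_nonneg x))
    (bound _ (posPart_nonneg x) (abs_posPart_le_abs x)) (intervalSup_nonneg f (negPart_nonneg x))
    (bound _ (negPart_nonneg x) hneg)

/-- The modulus `|f|` of a continuous functional on a normed lattice, given on the positive cone by
the Riesz-Kantorovich formula `|f| x = sup {f y : |y| ≤ x}`. -/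
noncomputable def dualModulus : StrongDual ℝ E :=
  (extendPositiveCone (intervalSup_add f)).toRealLinearMap
    (AddMonoidHomClass.continuous_of_bound _ ‖f‖ (norm_extendPositiveCone_intervalSup_le f))

theorem dualModulus_eq_intervalSup (hx : 0 ≤ x) : dualModulus f x = intervalSup f x :=
  extendPositiveCone_of_nonneg (intervalSup_add f) hx

theorem monotone_dualModulus : Monotone (dualModulus f) :=
  (monotone_iff_map_nonneg _).2 fun x hx => by
    rw [dualModulus_eq_intervalSup f hx]
    exact intervalSup_nonneg f hx

theorem abs_apply_le_dualModulus (hyx : |y| ≤ x) : |f y| ≤ dualModulus f x := by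
  rw [dualModulus_eq_intervalSup f ((abs_nonneg y).trans hyx)]
  refine abs_le'.2 ⟨le_intervalSup f hyx, ?_⟩
  rw [← map_neg]
  exact le_intervalSup f (by rwa [abs_neg])

end Modulus

section Uaw

variable {ι κ E : Type*} {l : Filter ι} [NormedAddCommGroup E] [NormedSpace ℝ E] [Lattice E]

theorem UawTendsto.comp {x : ι → E} {a : E} (hx : UawTendsto x l a) {φ : κ → ι} {l' : Filter κ}
    (hφ : Tendsto φ l' l) : UawTendsto (fun k => x (φ k)) l' a :=
  fun u hu f => (hx u hu f).comp hφ

theorem UawTendsto.sub_const {x : ι → E} {a : E} (hx : UawTendsto x l a) :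
    UawTendsto (fun i => x i - a) l 0 := by
  simpa only [UawTendsto, sub_zero] using hx

theorem UawContinuous.uawTendsto {F : Type*} [NormedAddCommGroup F] [NormedSpace ℝ F] [Lattice F]
    {T : E →L[ℝ] F} (hT : UawContinuous T) {x : ι → E} {a : E} (hx : UawTendsto x l a) :
    UawTendsto (fun i => T (x i)) l (T a) :=
  (hT (map x l) a fun u hu f => tendsto_map'_iff.2 (hx u hu f)).comp tendsto_map

variable [IsOrderedAddMonoid E]

theorem uawTendsto_pure (a : E) : UawTendsto (fun x => x) (pure a) a := fun u hu f => by
  simpa [hu] using tendsto_pure_nhds (fun x => f (|x - a| ⊓ u)) a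

variable [HasSolidNorm E]

theorem UawTendsto.of_abs_le {x y : ι → E} (hx : UawTendsto x l 0) (hyx : ∀ i, |y i| ≤ |x i|) :
    UawTendsto y l 0 := fun u hu f => by
  refine squeeze_zero_norm (fun i => abs_apply_le_dualModulus f ?_) (hx u hu (dualModulus f))
  rw [sub_zero, sub_zero, abs_of_nonneg (le_inf (abs_nonneg _) hu)]
  exact inf_le_inf_right _ (hyx i)

theorem UawTendsto.neg {x : ι → E} (hx : UawTendsto x l 0) : UawTendsto (fun i => -x i) l 0 :=
  hx.of_abs_le fun _ => (abs_neg _).le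

theorem UawTendsto.add {x y : ι → E} (hx : UawTendsto x l 0) (hy : UawTendsto y l 0) :
    UawTendsto (fun i => x i + y i) l 0 := fun u hu f => by
  have hsum := (hx u hu (dualModulus f)).add (hy u hu (dualModulus f))
  refine squeeze_zero_norm (fun i => ?_) (by simpa only [← map_add, add_zero] using hsum)
  refine abs_apply_le_dualModulus f ?_
  rw [sub_zero, sub_zero, sub_zero, abs_of_nonneg (le_inf (abs_nonneg _) hu)]
  exact (inf_le_inf_right _ (abs_add_le _ _)).trans
    (add_inf_le_inf_add_inf (abs_nonneg _) (abs_nonneg _) hu)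

theorem uawTendsto_zero_of_sum_inf_le {d : ℕ → E} (hd : ∀ n, 0 ≤ d n)
    (hsum : ∀ w, 0 ≤ w → ∃ b, ∀ N, ∑ n ∈ Finset.range N, d n ⊓ w ≤ b) :
    UawTendsto d atTop 0 := fun u hu f => by
  obtain ⟨b, hb⟩ := hsum u hu
  have hdu : ∀ n, 0 ≤ d n ⊓ u := fun n => le_inf (hd n) hu
  have hsummable : Summable fun n => dualModulus f (d n ⊓ u) := by
    refine summable_of_sum_range_le (c := dualModulus f b) (fun n => ?_) fun N => ?_
    · exact (monotone_iff_map_nonneg _).1 (monotone_dualModulus f) _ (hdu n)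
    · rw [← map_sum]
      exact monotone_dualModulus f (hb N)
  refine squeeze_zero_norm (fun n => abs_apply_le_dualModulus f ?_) hsummable.tendsto_atTop_zero
  rw [sub_zero, abs_of_nonneg (hd n), abs_of_nonneg (hdu n)]

theorem uawTendsto_zero_of_pairwise_inf_eq_zero {d : ℕ → E} (hd : ∀ n, 0 ≤ d n)
    (hdisj : Pairwise fun m n => d m ⊓ d n = 0) : UawTendsto d atTop 0 := by
  refine uawTendsto_zero_of_sum_inf_le hd fun w hw => ⟨w, fun N => ?_⟩
  have hdw : ∀ n, 0 ≤ d n ⊓ w := fun n => le_inf (hd n) hw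
  refine sum_le_of_pairwise_inf_eq_zero hdw (fun m n hmn => ?_) hw (fun _ => inf_le_right) _
  exact le_antisymm ((inf_le_inf inf_le_left inf_le_left).trans (hdisj hmn).le)
    (le_inf (hdw m) (hdw n))

/-- The functional `f` norming `|x i|` satisfies `f (|x j| ⊓ |x i|) → 0` along `j`, whereas
`|x j| ⊓ |x i|` stays close to `|x i|` by the Cauchy property. -/
theorem UawTendsto.tendsto_zero_of_cauchy_map {x : ι → E} (hx : UawTendsto x l 0)
    (hcauchy : Cauchy (map x l)) : Tendsto x l (𝓝 0) := by
  obtain ⟨hl, hdist⟩ := cauchy_map_iff.1 hcauchy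
  refine Metric.tendsto_nhds.2 fun ε hε => ?_
  have hclose : ∀ᶠ i in l, ∀ᶠ j in l, dist (x i) (x j) < ε / 2 :=
    (hdist.eventually (Metric.dist_mem_uniformity (half_pos hε))).curry
  filter_upwards [hclose] with i hi
  obtain ⟨f, hf_norm, hf⟩ := exists_dual_vector'' ℝ |x i|
  obtain ⟨j, hij, hfj⟩ :=
    (hi.and ((hx |x i| (abs_nonneg _) f).eventually (gt_mem_nhds (half_pos hε)))).exists
  have hdiff : f (|x i| ⊓ |x i| - |x j| ⊓ |x i|) ≤ dist (x i) (x j) :=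
    calc f (|x i| ⊓ |x i| - |x j| ⊓ |x i|)
        ≤ ‖f‖ * ‖|x i| ⊓ |x i| - |x j| ⊓ |x i|‖ := (le_abs_self _).trans (f.le_opNorm _)
      _ ≤ ‖|x i| ⊓ |x i| - |x j| ⊓ |x i|‖ := mul_le_of_le_one_left (norm_nonneg _) hf_norm
      _ ≤ ‖|x i| - |x j|‖ := norm_inf_sub_inf_le_norm _ _ _
      _ ≤ dist (x i) (x j) := by rw [dist_eq_norm]; exact norm_abs_sub_abs _ _
  rw [inf_idem, map_sub, hf, RCLike.ofReal_real_eq_id, id, norm_abs_eq_norm] at hdiff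
  rw [sub_zero] at hfj
  rw [dist_zero_right]
  linarith

end Uaw

section UniformPreLebesgue

theorem sum_mul_one_half_pow_le {c : ℝ} (hc : 0 ≤ c) (n : ℕ) :
    ∑ i ∈ Finset.range n, c * (1 / 2) ^ i ≤ c * 2 := by
  rw [← Finset.mul_sum]
  exact mul_le_mul_of_nonneg_left (sum_geometric_two_le n) hc

theorem apply_le_apply_inf'_add_sum {ι E H : Type*} [AddCommGroup E] [Lattice E]
    [IsOrderedAddMonoid E] [FunLike H E ℝ] [AddMonoidHomClass H E ℝ] {φ : H} (hφ : Monotone φ)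
    {s : Finset ι} (hs : s.Nonempty) {x : E} {V e : ι → E} (he : ∀ k ∈ s, 0 ≤ e k)
    (hx : ∀ k ∈ s, x ≤ V k + e k) : φ x ≤ φ (s.inf' hs V) + ∑ k ∈ s, φ (e k) := by
  rw [← map_sum, ← map_add]
  refine hφ (sub_le_iff_le_add.1 (Finset.le_inf' _ _ fun k hk => ?_))
  exact sub_le_iff_le_add.2 ((hx k hk).trans (by gcongr; exact Finset.single_le_sum he hk))

variable {E H : Type*} [AddCommGroup E] [Lattice E] [FunLike H E ℝ] {Φ : Set H} {u : E}

/-- The functionals in `Φ` are uniformly Cauchy along increasing sequences in `[0, u]`: uniformly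
on `Φ`, the pre-Lebesgue property of the lattice seminorms `x ↦ φ |x|`. -/
def UniformPreLebesgueOn (Φ : Set H) (u : E) : Prop :=
  ∀ a : ℕ → E, Monotone a → (∀ n, a n ∈ Set.Icc 0 u) →
    ∀ ε > 0, ∃ N, ∀ M ≥ N, ∀ φ ∈ Φ, φ (a M) - φ (a N) ≤ ε

namespace UniformPreLebesgueOn

variable [IsOrderedAddMonoid E] [AddMonoidHomClass H E ℝ]

theorem exists_forall_sub_le_of_antitone (hΦ : UniformPreLebesgueOn Φ u) {a : ℕ → E}
    (ha : Antitone a) (hau : ∀ n, a n ∈ Set.Icc 0 u) {ε : ℝ} (hε : 0 < ε) :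
    ∃ N, ∀ M ≥ N, ∀ φ ∈ Φ, φ (a N) - φ (a M) ≤ ε := by
  obtain ⟨N, hN⟩ := hΦ (fun n => u - a n) (fun m n hmn => sub_le_sub_left (ha hmn) u)
    (fun n => ⟨sub_nonneg.2 (hau n).2, sub_le_self u (hau n).1⟩) ε hε
  refine ⟨N, fun M hM φ hφ => ?_⟩
  simpa only [map_sub, sub_sub_sub_cancel_left] using hN M hM φ hφ

/-- `U` imitates the decreasing sequence `n ↦ ⨆ i ≥ n, x i`, which need not exist in `E`. -/
theorem exists_antitone (hΦ : UniformPreLebesgueOn Φ u) (hmono : ∀ φ ∈ Φ, Monotone φ)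
    {x : ℕ → E} (hx : ∀ n, x n ∈ Set.Icc 0 u) {ε : ℝ} (hε : 0 < ε) :
    ∃ U : ℕ → E, Antitone U ∧ (∀ n, U n ∈ Set.Icc 0 u) ∧
      (∀ n, ∃ j, U n ≤ ∑ i ∈ Finset.range j, x (n + i)) ∧
      ∀ n, ∀ φ ∈ Φ, φ (x n) ≤ φ (U n) + ε := by
  let W (n : ℕ) : ℕ →o E := partialSups fun i => x (n + i)
  have hxW : ∀ {n i j}, i ≤ j → x (n + i) ≤ W n j := fun {n _ _} =>
    le_partialSups_of_le fun i => x (n + i)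
  have hWu : ∀ n j, W n j ∈ Set.Icc 0 u := fun n j =>
    ⟨(hx _).1.trans (hxW j.zero_le), partialSups_le _ _ _ fun _ _ => (hx _).2⟩
  choose K hK using fun n => hΦ (W n) (W n).monotone (hWu n) (ε / 2 * (1 / 2) ^ n) (by positivity)
  let U (n : ℕ) : E := (Finset.range (n + 1)).inf' Finset.nonempty_range_add_one fun k => W k (K k)
  have hUW : ∀ n, U n ≤ W n (K n) := fun n => Finset.inf'_le _ (Finset.self_mem_range_succ n)
  refine ⟨U, fun m n hmn => ?_, fun n => ⟨?_, (hUW n).trans (hWu n _).2⟩, fun n => ?_,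
    fun n φ hφ => ?_⟩
  · exact Finset.inf'_mono _ (Finset.range_subset_range.2 (by gcongr)) _
  · exact Finset.le_inf' _ _ fun k _ => (hWu k _).1
  · exact ⟨K n + 1, (hUW n).trans (partialSups_le_sum (fun _ => (hx _).1) _)⟩
  · let J := n + (Finset.range (n + 1)).sup K
    have hKJ : ∀ k ∈ Finset.range (n + 1), K k ≤ J := fun k hk =>
      (Finset.le_sup hk).trans (Nat.le_add_left _ _)
    have hxJ : ∀ k ∈ Finset.range (n + 1), x n ≤ W k (K k) + (W k J - W k (K k)) := fun k hk => by
      rw [add_sub_cancel]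
      simpa only [Nat.add_sub_cancel' (Finset.mem_range_succ_iff.1 hk)] using
        hxW (n := k) ((Nat.sub_le n k).trans (Nat.le_add_right n _) : n - k ≤ J)
    calc φ (x n) ≤ φ (U n) + ∑ k ∈ Finset.range (n + 1), φ (W k J - W k (K k)) :=
          apply_le_apply_inf'_add_sum (hmono φ hφ) _
            (fun k hk => sub_nonneg.2 ((W k).monotone (hKJ k hk))) hxJ
      _ ≤ φ (U n) + ∑ k ∈ Finset.range (n + 1), ε / 2 * (1 / 2) ^ k := by
          gcongr with k hk
          rw [map_sub]
          exact hK k J (hKJ k hk) φ hφ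
      _ ≤ φ (U n) + ε := by
          gcongr
          exact (sum_mul_one_half_pow_le (half_pos hε).le _).trans_eq
            (div_mul_cancel₀ ε two_ne_zero)

theorem exists_apply_le (hΦ : UniformPreLebesgueOn Φ u) (hmono : ∀ φ ∈ Φ, Monotone φ)
    {x : ℕ → E} (hx : ∀ n, x n ∈ Set.Icc 0 u) {φ : ℕ → H} (hφ : ∀ n, φ n ∈ Φ) {η ε : ℝ}
    (htail : ∀ n j, ∑ i ∈ Finset.range j, φ n (x (n + 1 + i)) ≤ η) (hε : 0 < ε) :
    ∃ n, φ n (x n) ≤ η + ε := by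
  obtain ⟨U, hU, hUu, hUsum, hxU⟩ := hΦ.exists_antitone hmono hx (half_pos hε)
  obtain ⟨n, hn⟩ := hΦ.exists_forall_sub_le_of_antitone hU hUu (half_pos hε)
  obtain ⟨j, hj⟩ := hUsum (n + 1)
  refine ⟨n, ?_⟩
  have hx_le := hxU n (φ n) (hφ n)
  have hU_sub := hn (n + 1) n.le_succ (φ n) (hφ n)
  have hU_le : φ n (U (n + 1)) ≤ η :=
    calc φ n (U (n + 1)) ≤ φ n (∑ i ∈ Finset.range j, x (n + 1 + i)) := hmono _ (hφ n) hj
      _ ≤ η := by rw [map_sum]; exact htail n j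
  linarith

theorem exists_finite_control (hΦ : UniformPreLebesgueOn Φ u) (hmono : ∀ φ ∈ Φ, Monotone φ)
    {ε : ℝ} (hε : 0 < ε) : ∃ s ⊆ Φ, s.Finite ∧ ∃ δ > 0,
      ∀ x ∈ Set.Icc 0 u, (∀ φ ∈ s, φ x ≤ δ) → ∀ φ ∈ Φ, φ x ≤ ε := by
  by_contra! hcon
  obtain ⟨p, hp, hpp⟩ := exists_seq_of_forall_finset_exists
    (fun p : ℕ × H × E => p.2.1 ∈ Φ ∧ p.2.2 ∈ Set.Icc 0 u ∧ ε < p.2.1 p.2.2)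
    (fun p q => p.1 < q.1 ∧ p.2.1 q.2.2 ≤ ε / 4 * (1 / 2) ^ q.1) fun s hs => by
      let n := s.sup Prod.fst + 1
      obtain ⟨x, hxu, hxs, φ, hφ, hφx⟩ := hcon ((fun p : ℕ × H × E => p.2.1) '' s)
        (Set.image_subset_iff.2 fun p hp => (hs p hp).1) (s.finite_toSet.image _)
        (ε / 4 * (1 / 2) ^ n) (by positivity)
      exact ⟨(n, φ, x), ⟨hφ, hxu, hφx⟩, fun p hp =>
        ⟨Nat.lt_succ_of_le (Finset.le_sup (f := Prod.fst) hp), hxs _ (Set.mem_image_of_mem _ hp)⟩⟩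
  have hindex : StrictMono fun n => (p n).1 := fun m n hmn => (hpp m n hmn).1
  have htail : ∀ n j, ∑ i ∈ Finset.range j, (p n).2.1 (p (n + 1 + i)).2.2 ≤ ε / 2 := fun n j =>
    calc ∑ i ∈ Finset.range j, (p n).2.1 (p (n + 1 + i)).2.2
        ≤ ∑ i ∈ Finset.range j, ε / 4 * (1 / 2) ^ i := by
          refine Finset.sum_le_sum fun i _ => (hpp n _ (by omega)).2.trans ?_
          refine mul_le_mul_of_nonneg_left ?_ (by positivity)
          exact pow_le_pow_of_le_one (by norm_num) (by norm_num)
            (le_add_self.trans (hindex.id_le (n + 1 + i)))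
      _ ≤ ε / 4 * 2 := sum_mul_one_half_pow_le (by positivity) j
      _ = ε / 2 := by ring
  obtain ⟨n, hn⟩ := hΦ.exists_apply_le hmono (fun n => (hp n).2.1) (fun n => (hp n).1) htail
    (half_pos hε)
  exact absurd (hp n).2.2 (by linarith)

end UniformPreLebesgueOn

end UniformPreLebesgue

section AdjointModuli

variable {E F : Type*} [NormedAddCommGroup E] [NormedSpace ℝ E] [Lattice E]
  [IsOrderedAddMonoid E] [HasSolidNorm E] [NormedAddCommGroup F] [NormedSpace ℝ F]

/-- The moduli of the functionals `f ∘ T`, for `f` in the dual unit ball. Their supremum at `z ≥ 0`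
is the supremum of `‖T y‖` over `|y| ≤ z`. -/
def adjointModuli (T : E →L[ℝ] F) : Set (StrongDual ℝ E) :=
  (fun f : StrongDual ℝ F => dualModulus (f.comp T)) '' Metric.closedBall 0 1

variable {T : E →L[ℝ] F} {φ : StrongDual ℝ E} {y z : E} {c : ℝ}

theorem monotone_of_mem_adjointModuli (hφ : φ ∈ adjointModuli T) : Monotone φ := by
  obtain ⟨f, -, rfl⟩ := hφ
  exact monotone_dualModulus _

theorem norm_apply_le_of_forall_adjointModuli_le (hyz : |y| ≤ z)
    (hc : ∀ φ ∈ adjointModuli T, φ z ≤ c) : ‖T y‖ ≤ c := by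
  obtain ⟨f, hf_norm, hf⟩ := exists_dual_vector'' ℝ (T y)
  calc ‖T y‖ = (f.comp T) y := hf.symm
    _ ≤ dualModulus (f.comp T) z := (le_abs_self _).trans (abs_apply_le_dualModulus _ hyz)
    _ ≤ c := hc _ ⟨f, mem_closedBall_zero_iff.2 hf_norm, rfl⟩

theorem exists_lt_norm_apply_of_lt (hφ : φ ∈ adjointModuli T) (hz : 0 ≤ z) (hc : c < φ z) :
    ∃ y, |y| ≤ z ∧ c < ‖T y‖ := by
  obtain ⟨f, hf, rfl⟩ := hφ
  by_contra! hle
  refine hc.not_ge ((dualModulus_eq_intervalSup _ hz).trans_le (intervalSup_le _ hz fun y hy => ?_))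
  calc (f.comp T) y ≤ ‖f‖ * ‖T y‖ := (le_abs_self _).trans (f.le_opNorm _)
    _ ≤ ‖T y‖ := mul_le_of_le_one_left (norm_nonneg _) (mem_closedBall_zero_iff.1 hf)
    _ ≤ c := hle y hy

end AdjointModuli

section NullOnInterval

variable {E F : Type*} [NormedAddCommGroup E] [NormedSpace ℝ E] [Lattice E]
  [NormedAddCommGroup F] [NormedSpace ℝ F]

/-- `T` maps uaw-null sequences in the order interval `[-u, u]` to norm-null sequences: it is
order-L-weakly compact on this interval. -/
def NullOnInterval (T : E →L[ℝ] F) (u : E) : Prop :=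
  ∀ y : ℕ → E, (∀ n, |y n| ≤ u) → UawTendsto y atTop 0 → Tendsto (fun n => T (y n)) atTop (𝓝 0)

namespace NullOnInterval

variable [IsOrderedAddMonoid E] {T : E →L[ℝ] F} {u v : E}

theorem zero : NullOnInterval T 0 := fun y hy _ => by
  have hy_zero : ∀ n, y n = 0 := fun n =>
    le_antisymm ((le_abs_self _).trans (hy n)) (neg_nonpos.1 ((neg_le_abs _).trans (hy n)))
  simp only [hy_zero, map_zero, tendsto_const_nhds]

variable [HasSolidNorm E]

theorem add (hu : 0 ≤ u) (hv : 0 ≤ v) (hTu : NullOnInterval T u) (hTv : NullOnInterval T v) :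
    NullOnInterval T (u + v) := fun y hy hy_uaw => by
  choose y₁ y₂ hadd h₁ h₂ using fun n => exists_add_eq_of_abs_le_add_inf hu hv (hy n)
  have h₁_null := hTu y₁ (fun n => (h₁ n).trans inf_le_left)
    (hy_uaw.of_abs_le fun n => (h₁ n).trans inf_le_right)
  have h₂_null := hTv y₂ (fun n => (h₂ n).trans inf_le_left)
    (hy_uaw.of_abs_le fun n => (h₂ n).trans inf_le_right)
  simpa only [← map_add, hadd, add_zero] using h₁_null.add h₂_null

theorem of_mem_closure {X : Set E} (hX : ∀ x ∈ X, 0 ≤ x ∧ NullOnInterval T x)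
    (hu : u ∈ AddSubmonoid.closure X) : 0 ≤ u ∧ NullOnInterval T u := by
  induction hu using AddSubmonoid.closure_induction with
  | mem x hx => exact hX x hx
  | zero => exact ⟨le_rfl, zero⟩
  | add x y _ _ hx hy => exact ⟨add_nonneg hx.1 hy.1, add hx.1 hy.1 hx.2 hy.2⟩

theorem uniformPreLebesgueOn (hTu : NullOnInterval T u) :
    UniformPreLebesgueOn (adjointModuli T) u := by
  intro a ha hau ε hε
  by_contra! hcon
  have hjump : ∀ N, ∃ M y, |y| ≤ a M - a N ∧ ε < ‖T y‖ := fun N => by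
    obtain ⟨M, hNM, φ, hφ, hlt⟩ := hcon N
    rw [← map_sub] at hlt
    exact ⟨M, exists_lt_norm_apply_of_lt hφ (sub_nonneg.2 (ha hNM)) hlt⟩
  choose M y hy hTy using hjump
  let k (n : ℕ) : ℕ := M^[n] 0
  let d (n : ℕ) : E := a (k (n + 1)) - a (k n)
  have hyd : ∀ n, |y (k n)| ≤ d n := fun n => by
    simpa only [d, k, Function.iterate_succ_apply'] using hy (k n)
  have hd : ∀ n, 0 ≤ d n := fun n => (abs_nonneg _).trans (hyd n)
  have hdu : ∀ n, d n ≤ u := fun n => (sub_le_self _ (hau _).1).trans (hau _).2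
  have hd_uaw : UawTendsto d atTop 0 := uawTendsto_zero_of_sum_inf_le hd fun w _ => ⟨u, fun N =>
    calc ∑ n ∈ Finset.range N, d n ⊓ w ≤ ∑ n ∈ Finset.range N, d n :=
          Finset.sum_le_sum fun n _ => inf_le_left
      _ = a (k N) - a (k 0) := Finset.sum_range_sub (fun n => a (k n)) N
      _ ≤ u := (sub_le_self _ (hau _).1).trans (hau _).2⟩
  have hTy_null := hTu (fun n => y (k n)) (fun n => (hyd n).trans (hdu n))
    (hd_uaw.of_abs_le fun n => (hyd n).trans (le_abs_self _))
  obtain ⟨n, hn⟩ := (hTy_null.norm.eventually (gt_mem_nhds (by rwa [norm_zero]))).exists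
  exact (hTy (k n)).not_gt hn

theorem tendsto_zero_of_weakly_null (hTu : NullOnInterval T u) {ι : Type*} {l : Filter ι}
    {x : ι → E} (hxu : ∀ i, x i ∈ Set.Icc 0 u)
    (hx : ∀ f : StrongDual ℝ E, Tendsto (fun i => f (x i)) l (𝓝 0)) :
    Tendsto (fun i => T (x i)) l (𝓝 0) := by
  refine Metric.nhds_basis_closedBall.tendsto_right_iff.2 fun ε hε => ?_
  obtain ⟨s, -, hs_fin, δ, hδ, hs⟩ := hTu.uniformPreLebesgueOn.exists_finite_control
    (fun _ => monotone_of_mem_adjointModuli) hε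
  have hsmall : ∀ᶠ i in l, ∀ φ ∈ s, φ (x i) ≤ δ :=
    hs_fin.eventually_all.2 fun φ _ => (hx φ).eventually_le_const hδ
  filter_upwards [hsmall] with i hi
  exact mem_closedBall_zero_iff.2
    (norm_apply_le_of_forall_adjointModuli_le (abs_of_nonneg (hxu i).1).le (hs _ (hxu i) hi))

end NullOnInterval

end NullOnInterval

section DisjointTails

variable {E : Type*} [AddCommGroup E] [Lattice E] [IsOrderedAddMonoid E] [Module ℝ E]
  [IsOrderedModule ℝ E]

theorem posPart_sub_smul_inf_posPart_sub_smul {a b : E} {c r : ℝ} (ha : 0 ≤ a) (hc : 1 ≤ c)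
    (hcr : 1 ≤ c * r) : (a - c • b)⁺ ⊓ (b - r • a)⁺ = 0 := by
  have hc_pos : 0 < c := zero_lt_one.trans_le hc
  have hle : b - r • a ≤ (a - c • b)⁻ :=
    calc b - r • a ≤ b - c⁻¹ • a :=
          sub_le_sub_left
            (smul_le_smul_of_nonneg_right ((inv_le_iff_one_le_mul₀' hc_pos).2 hcr) ha) b
      _ = c⁻¹ • -(a - c • b) := by rw [neg_sub, smul_sub, inv_smul_smul₀ hc_pos.ne']
      _ ≤ c⁻¹ • (a - c • b)⁻ :=
          smul_le_smul_of_nonneg_left (neg_le_negPart _) (inv_nonneg.2 hc_pos.le)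
      _ ≤ (a - c • b)⁻ := smul_le_of_le_one_left (negPart_nonneg _) (inv_le_one_of_one_le₀ hc)
  refine le_antisymm ?_ (le_inf (posPart_nonneg _) (posPart_nonneg _))
  exact (inf_le_inf_left _ (sup_le hle (negPart_nonneg _))).trans_eq (posPart_inf_negPart_eq_zero _)

/-- The disjoint sequence of the Kadec-Pełczyński type splitting: `x n` loses what lies below large
multiples of its predecessors, and a small multiple of a common bound for all later terms. -/
theorem pairwise_posPart_sub_smul_sum_inf_eq_zero {x : ℕ → E} {w : E} (hx : ∀ n, 0 ≤ x n)
    (hw : 0 ≤ w) (hxw : ∀ n, (1 / 2 : ℝ) ^ n • x n ≤ w) :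
    Pairwise fun m n =>
      (x m - (4 : ℝ) ^ m • ∑ k ∈ Finset.range m, x k - (1 / 2 : ℝ) ^ m • w)⁺ ⊓
        (x n - (4 : ℝ) ^ n • ∑ k ∈ Finset.range n, x k - (1 / 2 : ℝ) ^ n • w)⁺ = 0 := by
  set y : ℕ → E := fun n => x n - (4 : ℝ) ^ n • ∑ k ∈ Finset.range n, x k - (1 / 2 : ℝ) ^ n • w
  have hsum : ∀ n, 0 ≤ (4 : ℝ) ^ n • ∑ k ∈ Finset.range n, x k := fun n =>
    smul_nonneg (by positivity) (Finset.sum_nonneg fun k _ => hx k)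
  have hlt : ∀ m n, m < n → (y n)⁺ ⊓ (y m)⁺ = 0 := fun m n hmn => by
    have hyn : y n ≤ x n - (4 : ℝ) ^ n • x m :=
      (sub_le_self _ (smul_nonneg (by positivity) hw)).trans <| sub_le_sub_left
        (smul_le_smul_of_nonneg_left
          (Finset.single_le_sum (fun k _ => hx k) (Finset.mem_range.2 hmn)) (by positivity)) _
    have hym : y m ≤ x m - (1 / 2 : ℝ) ^ (m + n) • x n := by
      rw [pow_add, mul_smul]
      exact sub_le_sub (sub_le_self _ (hsum m))
        (smul_le_smul_of_nonneg_left (hxw n) (by positivity))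
    have hcr : (1 : ℝ) ≤ 4 ^ n * (1 / 2) ^ (m + n) :=
      calc (1 : ℝ) = 4 ^ n * (1 / 2) ^ (n + n) := by rw [← two_mul, pow_mul, ← mul_pow]; norm_num
        _ ≤ 4 ^ n * (1 / 2) ^ (m + n) := mul_le_mul_of_nonneg_left
            (pow_le_pow_of_le_one (by norm_num) (by norm_num) (by omega)) (by positivity)
    refine le_antisymm ((inf_le_inf (posPart_mono hyn) (posPart_mono hym)).trans_eq ?_)
      (le_inf (posPart_nonneg _) (posPart_nonneg _))
    exact posPart_sub_smul_inf_posPart_sub_smul (hx n) (one_le_pow₀ (by norm_num)) hcr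
  intro m n hmn
  rcases hmn.lt_or_gt with h | h
  · rw [inf_comm]
    exact hlt m n h
  · exact hlt n m h

end DisjointTails

section LWeaklyCompact

open LatticeOrderedAddCommGroup

theorem subset_solidClosure {E : Type*} [AddCommGroup E] [Lattice E] (S : Set E) :
    S ⊆ solidClosure S := fun x hx => ⟨x, hx, le_rfl⟩

theorem isBounded_solidClosure {E : Type*} [NormedAddCommGroup E] [Lattice E] [HasSolidNorm E]
    {S : Set E} (hS : Bornology.IsBounded S) : Bornology.IsBounded (solidClosure S) := by
  obtain ⟨C, hC⟩ := hS.exists_norm_le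
  refine isBounded_iff_forall_norm_le.2 ⟨C, ?_⟩
  rintro x ⟨z, hz, hxz⟩
  exact (norm_le_norm_of_abs_le_abs hxz).trans (hC z hz)

variable {E F : Type*} [NormedAddCommGroup E] [NormedSpace ℝ E] [Lattice E]
  [NormedAddCommGroup F] [NormedSpace ℝ F] {S : Set E} {T : E →L[ℝ] F}

namespace IsLWeaklyCompactOn

theorem mono (h : IsLWeaklyCompactOn S T) {A : Set E} (hA : A ⊆ solidClosure S) :
    IsLWeaklyCompactOn A T := fun x hx =>
  h x fun n => solidClosure_min hA (isSolid_solidClosure S) (hx n)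

theorem nullOnInterval (h : IsLWeaklyCompactOn S T) {x : E} (hx : x ∈ solidClosure S) :
    NullOnInterval T x := fun y hy =>
  h y fun n => isSolid_solidClosure S hx ((hy n).trans (le_abs_self x))

variable [IsOrderedAddMonoid E] [HasSolidNorm E] [IsOrderedModule ℝ E] [CompleteSpace E]

theorem tendsto_map_posPart_sub_smul_sum (h : IsLWeaklyCompactOn S T) (hS : Bornology.IsBounded S)
    {x : ℕ → E} (hxS : ∀ n, x n ∈ solidClosure S) (hx : ∀ n, 0 ≤ x n) :
    Tendsto (fun n => T (x n - (4 : ℝ) ^ n • ∑ k ∈ Finset.range n, x k)⁺) atTop (𝓝 0) := by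
  obtain ⟨C, hC⟩ := (isBounded_solidClosure hS).exists_norm_le
  have hterm : ∀ n, 0 ≤ (1 / 2 : ℝ) ^ n • x n := fun n => smul_nonneg (by positivity) (hx n)
  have hsummable : Summable fun n => (1 / 2 : ℝ) ^ n • x n := by
    refine .of_norm_bounded (g := fun n => (1 / 2 : ℝ) ^ n * C)
      (summable_geometric_two.mul_right C) fun n => ?_
    rw [norm_smul, norm_pow, Real.norm_of_nonneg one_half_pos.le]
    exact mul_le_mul_of_nonneg_left (hC _ (hxS n)) (by positivity)
  let w := ∑' n, (1 / 2 : ℝ) ^ n • x n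
  have hw : 0 ≤ w := tsum_nonneg hterm
  let v (n : ℕ) : E := x n - (4 : ℝ) ^ n • ∑ k ∈ Finset.range n, x k
  let y (n : ℕ) : E := (v n - (1 / 2 : ℝ) ^ n • w)⁺
  have hyx : ∀ n, y n ≤ x n := fun n => by
    refine sup_le ((sub_le_self _ (smul_nonneg (by positivity) hw)).trans (sub_le_self _ ?_)) (hx n)
    exact smul_nonneg (by positivity) (Finset.sum_nonneg fun k _ => hx k)
  have hyS : ∀ n, y n ∈ solidClosure S := fun n =>
    isSolid_solidClosure S (hxS n) (abs_le_abs_of_nonneg (posPart_nonneg _) (hyx n))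
  have hTy : Tendsto (fun n => T (y n)) atTop (𝓝 0) :=
    h y hyS <| uawTendsto_zero_of_pairwise_inf_eq_zero (fun _ => posPart_nonneg _) <|
      pairwise_posPart_sub_smul_sum_inf_eq_zero hx hw fun n =>
        hsummable.le_tsum n fun k _ => hterm k
  have hvy : Tendsto (fun n => (v n)⁺ - y n) atTop (𝓝 0) := by
    have hw_null : Tendsto (fun n : ℕ => (1 / 2 : ℝ) ^ n • w) atTop (𝓝 0) := by
      simpa only [zero_smul] using
        (tendsto_pow_atTop_nhds_zero_of_lt_one (r := (1 / 2 : ℝ)) one_half_pos.le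
          one_half_lt_one).smul_const w
    refine squeeze_zero_norm (fun n => ?_) (tendsto_zero_iff_norm_tendsto_zero.1 hw_null)
    exact (norm_sup_sub_sup_le_norm _ _ _).trans_eq (by rw [sub_sub_cancel])
  simpa only [Function.comp_def, map_sub, sub_add_cancel, add_zero] using
    ((T.continuous.tendsto' 0 0 (map_zero T)).comp hvy).add hTy

theorem exists_norm_map_posPart_sub_le (h : IsLWeaklyCompactOn S T) (hS : Bornology.IsBounded S)
    {ε : ℝ} (hε : 0 < ε) : ∃ u, 0 ≤ u ∧ NullOnInterval T u ∧
      ∀ x ∈ solidClosure S, 0 ≤ x → ‖T (x - u)⁺‖ ≤ ε := by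
  let P := AddSubmonoid.closure {x ∈ solidClosure S | 0 ≤ x}
  suffices hP : ∃ u ∈ P, ∀ x ∈ solidClosure S, 0 ≤ x → ‖T (x - u)⁺‖ ≤ ε by
    obtain ⟨u, huP, hu⟩ := hP
    obtain ⟨hu_nonneg, hu_null⟩ :=
      NullOnInterval.of_mem_closure (fun x hx => ⟨hx.2, h.nullOnInterval hx.1⟩) huP
    exact ⟨u, hu_nonneg, hu_null, hu⟩
  by_contra! hcon
  choose! X hXS hX hTX using hcon
  let s (n : ℕ) : E := Nat.rec 0 (fun k v => v + X (4 ^ k • v)) n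
  have hsP : ∀ n, s n ∈ P := fun n => by
    induction n with
    | zero => exact P.zero_mem
    | succ n ih =>
      have hmem := P.nsmul_mem ih (4 ^ n)
      exact P.add_mem ih (AddSubmonoid.subset_closure ⟨hXS _ hmem, hX _ hmem⟩)
  have hmem : ∀ n, 4 ^ n • s n ∈ P := fun n => P.nsmul_mem (hsP n) _
  let x (n : ℕ) : E := X (4 ^ n • s n)
  have hsum : ∀ n, (4 : ℝ) ^ n • ∑ k ∈ Finset.range n, x k = 4 ^ n • s n := fun n => by
    have : ∑ k ∈ Finset.range n, x k = s n :=
      Finset.sum_range_induction _ _ rfl n fun k _ => rfl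
    rw [this, ← Nat.cast_smul_eq_nsmul ℝ, Nat.cast_pow, Nat.cast_ofNat]
  have hTx := h.tendsto_map_posPart_sub_smul_sum hS (x := x) (fun n => hXS _ (hmem n))
    fun n => hX _ (hmem n)
  obtain ⟨n, hn⟩ := (hTx.norm.eventually (gt_mem_nhds (by rwa [norm_zero]))).exists
  rw [hsum] at hn
  exact (hTX _ (hmem n)).not_gt hn

theorem tendsto_map_of_nonneg (h : IsLWeaklyCompactOn S T) (hS : Bornology.IsBounded S)
    {ι : Type*} {l : Filter ι} {x : ι → E} (hxS : ∀ᶠ i in l, x i ∈ solidClosure S)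
    (hx_nonneg : ∀ i, 0 ≤ x i) (hx : UawTendsto x l 0) :
    Tendsto (fun i => T (x i)) l (𝓝 0) := by
  refine Metric.tendsto_nhds.2 fun ε hε => ?_
  obtain ⟨u, hu_nonneg, hu_null, hu⟩ := h.exists_norm_map_posPart_sub_le hS (half_pos hε)
  have hinf : Tendsto (fun i => T (x i ⊓ u)) l (𝓝 0) :=
    hu_null.tendsto_zero_of_weakly_null (fun i => ⟨le_inf (hx_nonneg i) hu_nonneg, inf_le_right⟩)
      fun f => by simpa only [sub_zero, abs_of_nonneg (hx_nonneg _)] using hx u hu_nonneg f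
  filter_upwards [hxS, Metric.tendsto_nhds.1 hinf _ (half_pos hε)] with i hi hi_inf
  rw [dist_zero_right] at hi_inf ⊢
  calc ‖T (x i)‖ = ‖T (x i - u)⁺ + T (x i ⊓ u)‖ := by
        rw [← map_add, inf_eq_sub_posPart_sub, add_sub_cancel]
    _ ≤ ‖T (x i - u)⁺‖ + ‖T (x i ⊓ u)‖ := norm_add_le _ _
    _ < ε / 2 + ε / 2 := add_lt_add_of_le_of_lt (hu _ hi (hx_nonneg i)) hi_inf
    _ = ε := add_halves ε

theorem tendsto_map_of_uawTendsto_zero (h : IsLWeaklyCompactOn S T) (hS : Bornology.IsBounded S)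
    {ι : Type*} {l : Filter ι} {x : ι → E} (hxS : ∀ᶠ i in l, x i ∈ solidClosure S)
    (hx : UawTendsto x l 0) : Tendsto (fun i => T (x i)) l (𝓝 0) := by
  have hpos : ∀ y : ι → E, (∀ᶠ i in l, y i ∈ solidClosure S) → UawTendsto y l 0 →
      Tendsto (fun i => T (y i)⁺) l (𝓝 0) := fun y hyS hy =>
    h.tendsto_map_of_nonneg hS
      (hyS.mono fun i hi => isSolid_solidClosure S hi (abs_posPart_le_abs _))
      (fun i => posPart_nonneg _) (hy.of_abs_le fun i => abs_posPart_le_abs _)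
  have hneg := hpos (fun i => -x i)
    (hxS.mono fun i hi => isSolid_solidClosure S hi (abs_neg _).le) hx.neg
  simpa only [posPart_neg, ← map_sub, posPart_sub_negPart, sub_zero] using (hpos x hxS hx).sub hneg

theorem tendsto_map_sub_map (h : IsLWeaklyCompactOn S T) (hS : Bornology.IsBounded S)
    {ι : Type*} {l : Filter ι} {x y : ι → E} (hxS : ∀ᶠ i in l, x i ∈ solidClosure S)
    (hyS : ∀ᶠ i in l, y i ∈ solidClosure S) (hxy : UawTendsto (fun i => x i - y i) l 0) :
    Tendsto (fun i => T (x i) - T (y i)) l (𝓝 0) := by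
  have hle : ∀ i, |x i - y i| ≤ |x i| + |y i| := fun i => by
    rw [sub_eq_add_neg, ← abs_neg (y i)]
    exact abs_add_le _ _
  choose a b hab ha hb using fun i =>
    exists_add_eq_of_abs_le_add_inf (abs_nonneg (x i)) (abs_nonneg (y i)) (hle i)
  have hTa := h.tendsto_map_of_uawTendsto_zero hS
    (hxS.mono fun i hi => isSolid_solidClosure S hi ((ha i).trans inf_le_left))
    (hxy.of_abs_le fun i => (ha i).trans inf_le_right)
  have hTb := h.tendsto_map_of_uawTendsto_zero hS
    (hyS.mono fun i hi => isSolid_solidClosure S hi ((hb i).trans inf_le_left))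
    (hxy.of_abs_le fun i => (hb i).trans inf_le_right)
  simpa only [← map_add, hab, map_sub, add_zero] using hTa.add hTb

theorem cauchy_map (h : IsLWeaklyCompactOn S T) (hS : Bornology.IsBounded S) {l : Filter E}
    [l.NeBot] (hl : solidClosure S ∈ l) {a : E} (ha : UawTendsto (fun x => x) l a) :
    Cauchy (map T l) := by
  have hfst := ha.sub_const.comp (tendsto_fst (f := l) (g := l))
  have hsnd := ha.sub_const.comp (tendsto_snd (f := l) (g := l))
  have hsub : UawTendsto (fun p : E × E => p.2 - p.1) (l ×ˢ l) 0 := by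
    simpa only [neg_sub, sub_add_sub_cancel] using hsnd.add hfst.neg
  refine cauchy_map_iff.2 ⟨inferInstance, ?_⟩
  rw [uniformity_eq_comap_nhds_zero, tendsto_comap_iff]
  exact h.tendsto_map_sub_map hS (tendsto_snd.eventually hl) (tendsto_fst.eventually hl) hsub

theorem tendsto_map (h : IsLWeaklyCompactOn S T) (hS : Bornology.IsBounded S) {l : Filter E}
    (hl : solidClosure S ∈ l) {a : E} (haS : a ∈ solidClosure S)
    (ha : UawTendsto (fun x => x) l a) : Tendsto T l (𝓝 (T a)) :=
  tendsto_sub_nhds_zero_iff.1 (h.tendsto_map_sub_map hS hl (.of_forall fun _ => haS) ha.sub_const)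

end IsLWeaklyCompactOn

theorem IsUawCompact.isRelUawCompact {A : Set E} (hA : IsUawCompact A) : IsRelUawCompact A :=
  ⟨hA.1, fun l hl hlA =>
    let ⟨l', hl', hle, a, _, ha⟩ := hA.2 l hl hlA
    ⟨l', hl', hle, a, ha⟩⟩

theorem IsRelUawCompact.exists_uawTendsto {A : Set E} (hA : IsRelUawCompact A)
    {g : Ultrafilter E} (hg : A ∈ g) : ∃ a, UawTendsto (fun x => x) (g : Filter E) a := by
  obtain ⟨l, _, hlg, a, ha⟩ := hA.2 g g.neBot (le_principal_iff.2 hg)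
  exact ⟨a, g.unique hlg ▸ ha⟩

theorem IsUawCompact.exists_uawTendsto {A : Set E} (hA : IsUawCompact A)
    {g : Ultrafilter E} (hg : A ∈ g) : ∃ a ∈ A, UawTendsto (fun x => x) (g : Filter E) a := by
  obtain ⟨l, _, hlg, a, haA, ha⟩ := hA.2 g g.neBot (le_principal_iff.2 hg)
  exact ⟨a, haA, g.unique hlg ▸ ha⟩

variable [IsOrderedAddMonoid E]

theorem isUawCompact_insert_zero_range {x : ℕ → E} (hx : UawTendsto x atTop 0)
    (hx_bdd : Bornology.IsBounded (Set.range x)) : IsUawCompact (insert 0 (Set.range x)) := by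
  refine ⟨hx_bdd.insert 0, fun l _ hlA => ?_⟩
  obtain ⟨g, hgl⟩ := exists_ultrafilter_le l
  suffices hg : ∃ a ∈ insert 0 (Set.range x), UawTendsto (fun z => z) (g : Filter E) a from
    ⟨g, g.neBot, hgl, hg⟩
  rcases Ultrafilter.union_mem_iff.1 (le_principal_iff.1 (hgl.trans hlA)) with h_zero | h_range
  · obtain ⟨_, rfl, rfl⟩ := Ultrafilter.eq_pure_of_finite_mem (Set.finite_singleton 0) h_zero
    exact ⟨0, Set.mem_insert _ _, uawTendsto_pure 0⟩
  rw [← Set.image_univ] at h_range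
  rw [← Ultrafilter.ofComapInfPrincipal_eq_of_map h_range]
  rcases (Ultrafilter.ofComapInfPrincipal h_range).le_cofinite_or_eq_pure with h_atTop | ⟨n, hn⟩
  · rw [Nat.cofinite_eq_atTop] at h_atTop
    exact ⟨0, Set.mem_insert _ _, fun u hu f => tendsto_map'_iff.2 ((hx u hu f).mono_left h_atTop)⟩
  · rw [hn, Ultrafilter.map_pure]
    exact ⟨x n, Set.mem_insert_of_mem _ (Set.mem_range_self n), uawTendsto_pure _⟩

variable [HasSolidNorm E]

theorem IsLWeaklyCompactOn.of_totallyBounded_image [Lattice F] [IsOrderedAddMonoid F]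
    [HasSolidNorm F] (hS : Bornology.IsBounded S) (hT : UawContinuous T)
    (h : ∀ A ⊆ solidClosure S, IsUawCompact A → TotallyBounded (T '' A)) :
    IsLWeaklyCompactOn S T := by
  intro x hxS hx
  have hx_range : Set.range x ⊆ solidClosure S := Set.range_subset_iff.2 hxS
  have hAS : insert 0 (Set.range x) ⊆ solidClosure S := Set.insert_subset
    (isSolid_solidClosure S (hxS 0) (by rw [abs_zero]; exact abs_nonneg _)) hx_range
  have htb := h _ hAS
    (isUawCompact_insert_zero_range hx ((isBounded_solidClosure hS).subset hx_range))
  have hTx : UawTendsto (fun n => T (x n)) atTop 0 := map_zero T ▸ hT.uawTendsto hx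
  refine tendsto_iff_ultrafilter _ _ _ |>.2 fun g hg => ?_
  have hcauchy : Cauchy (map (fun n => T (x n)) g) :=
    totallyBounded_iff_ultrafilter.1 htb (g.map fun n => T (x n)) <| le_principal_iff.2 <|
      mem_map.2 <| univ_mem' fun n =>
        Set.mem_image_of_mem T (Set.mem_insert_of_mem _ (Set.mem_range_self n))
  exact (hTx.comp hg).tendsto_zero_of_cauchy_map hcauchy

variable [IsOrderedModule ℝ E] [CompleteSpace E]

theorem IsLWeaklyCompactOn.totallyBounded_image (h : IsLWeaklyCompactOn S T) {A : Set E}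
    (hAS : A ⊆ solidClosure S) (hA : IsRelUawCompact A) : TotallyBounded (T '' A) := by
  refine totallyBounded_iff_ultrafilter.2 fun g hg => ?_
  have hgA : T '' A ∈ g := le_principal_iff.1 hg
  have hA_mem := Ultrafilter.ofComapInfPrincipal_mem hgA
  obtain ⟨a, ha⟩ := hA.exists_uawTendsto hA_mem
  rw [← Ultrafilter.ofComapInfPrincipal_eq_of_map hgA]
  exact (h.mono hAS).cauchy_map hA.1 (mem_of_superset hA_mem (subset_solidClosure A)) ha

theorem IsLWeaklyCompactOn.isCompact_image (h : IsLWeaklyCompactOn S T) {A : Set E}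
    (hAS : A ⊆ solidClosure S) (hA : IsUawCompact A) : IsCompact (T '' A) := by
  refine isCompact_iff_ultrafilter_le_nhds.2 fun g hg => ?_
  have hgA : T '' A ∈ g := le_principal_iff.1 hg
  have hA_mem := Ultrafilter.ofComapInfPrincipal_mem hgA
  obtain ⟨a, haA, ha⟩ := hA.exists_uawTendsto hA_mem
  refine ⟨T a, Set.mem_image_of_mem T haA, ?_⟩
  rw [← Ultrafilter.ofComapInfPrincipal_eq_of_map hgA]
  exact (h.mono hAS).tendsto_map hA.1 (mem_of_superset hA_mem (subset_solidClosure A))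
    (subset_solidClosure A haA) ha

end LWeaklyCompact

theorem isCompact_closure_iff_totallyBounded {X : Type*} [UniformSpace X] [CompleteSpace X]
    {s : Set X} : IsCompact (closure s) ↔ TotallyBounded s := by
  rw [isCompact_iff_totallyBounded_isComplete, totallyBounded_closure,
    and_iff_left isClosed_closure.isComplete]

theorem proposition3p9_general {E F : Type*}
    [NormedAddCommGroup E] [NormedSpace ℝ E] [CompleteSpace E]
    [Lattice E] [IsOrderedAddMonoid E] [IsOrderedModule ℝ E] [HasSolidNorm E]
    [NormedAddCommGroup F] [NormedSpace ℝ F] [Lattice F] [IsOrderedAddMonoid F] [HasSolidNorm F]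
    (S : Set E) (T : E →L[ℝ] F) :
    (Bornology.IsBounded S → UawContinuous T →
      List.TFAE [
        IsLWeaklyCompactOn S T,
        ∀ A : Set E, A ⊆ LatticeOrderedAddCommGroup.solidClosure S →
          IsRelUawCompact A → TotallyBounded (T '' A),
        ∀ A : Set E, A ⊆ LatticeOrderedAddCommGroup.solidClosure S →
          IsUawCompact A → IsCompact (T '' A)]) ∧
    (IsLWeaklyCompactOn S T →
      (∀ A : Set E, A ⊆ LatticeOrderedAddCommGroup.solidClosure S →
        IsRelUawCompact A → TotallyBounded (T '' A)) ∧
      (∀ A : Set E, A ⊆ LatticeOrderedAddCommGroup.solidClosure S →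
        IsUawCompact A → IsCompact (T '' A))) := by
  refine ⟨fun hS hT => ?_, fun h => ⟨fun _ => h.totallyBounded_image, fun _ => h.isCompact_image⟩⟩
  tfae_have 1 → 2 := fun h _ => h.totallyBounded_image
  tfae_have 1 → 3 := fun h _ => h.isCompact_image
  tfae_have 2 → 1 := fun h => .of_totallyBounded_image hS hT fun A hAS hA =>
    h A hAS hA.isRelUawCompact
  tfae_have 3 → 1 := fun h => .of_totallyBounded_image hS hT fun A hAS hA =>
    (h A hAS hA).totallyBounded
  tfae_finish

theorem proposition3p9
    {E F : Type*}
    [NormedAddCommGroup E] [NormedSpace ℝ E] [CompleteSpace E]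
    [Lattice E] [IsOrderedAddMonoid E] [IsOrderedModule ℝ E] [HasSolidNorm E]
    [NormedAddCommGroup F] [NormedSpace ℝ F] [CompleteSpace F]
    [Lattice F] [IsOrderedAddMonoid F] [IsOrderedModule ℝ F] [HasSolidNorm F]
    (S : Set E) (hS : Bornology.IsBounded S) (T : E →L[ℝ] F) :
    (UawContinuous T →
      List.TFAE [
        IsLWeaklyCompactOn S T,
        ∀ A : Set E, A ⊆ LatticeOrderedAddCommGroup.solidClosure S →
          IsRelUawCompact A → IsCompact (closure (T '' A)),
        ∀ A : Set E, A ⊆ LatticeOrderedAddCommGroup.solidClosure S →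
          IsUawCompact A → IsCompact (T '' A)]) ∧
    (IsLWeaklyCompactOn S T →
      (∀ A : Set E, A ⊆ LatticeOrderedAddCommGroup.solidClosure S →
        IsRelUawCompact A → IsCompact (closure (T '' A))) ∧
      (∀ A : Set E, A ⊆ LatticeOrderedAddCommGroup.solidClosure S →
        IsUawCompact A → IsCompact (T '' A))) := by
  simpa only [isCompact_closure_iff_totallyBounded] using
    And.imp_left (fun h => h hS) (proposition3p9_general S T)
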